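/- Let $u$ be a linear functional on $\mathbb{C}[x]$ with moments $(u)_n=\langle u,x^n\rangle$, and let $\{P_n\}_{n\ge0}$ be its monic orthogonal polynomial sequence: $P_n$ is monic of degree $n$, $\langle u,P_nP_m\rangle=0$ for $n\ne m$, and $\langle u,P_n^2\rangle\neq0$. Suppose that $u$ is a Laguerre–Hahn form, that is, $(u)_0=1$ and there are polynomials $\Phi,B,C,D\in\mathbb{C}[x]$ such that the formal Stieltjes function $S(z)=-\sum_{n\ge0}(u)_n z^{-n-1}$ satisfies $\Phi S'=BS^2+CS+D$. Let $P^{(1)}_n(x)=\left\langle u,\frac{P_{n+1}(x)-P_{n+1}(\xi)}{x-\xi}\right\rangle$ for $n\ge -1$, where $u$ acts on $\xi$ (so $P^{(1)}_{-1}=0$). Then $\{P_n\}$ satisfies a recurrence $P_0=1$, $P_1=x-\beta_0$, $P_{n+2}=(x-\beta_{n+1})P_{n+1}-\gamma_{n+1}P_n$ with $\beta_n\in\mathbb{C}$ and $\gamma_{n+1}\in\mathbb{C}\setminus\{0\}$ for $n\geq0$. Put $B_0=B$, $C_0=C$, $D_0=D$, $D_{-1}=B$, $\gamma_0=1$, and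 define polynomials $C_n,D_n$ by $$C_{n+1}=-C_n+2(x-\beta_n)D_n,\qquad \gamma_{n+1}D_{n+1}=-\Phi+\gamma_nD_{n-1}-(x-\beta_n)C_n+(x-\beta_n)^2D_n,\qquad n\ge0.$$ Write $C_n^{\pm}=C_{n+1}\pm C_0$. For every $n\ge0$ and $k=1,2,3,4$, $$G_{0,k}P^{(1)}_{n-1}+G_{1,k}P^{(1)}_n+H_kP_n=\Phi^kP_{n+1}^{(k)}+\sum_{j=0}^{k-1}M_{j,k}P_{n+1}^{(j)},$$ where superscripts $(j)$ on $P_{n+1}$ on the right denote derivatives and the coefficients are the following polynomials in $x$ (depending on $n$). For $k=1$: $$G_{0,1}=0,\quad G_{1,1}=B_0,\quad H_1=-\gamma_{n+1}D_{n+1},\quad M_{0,1}=-\tfrac12C_n^-.$$ For $k=2$: $$G_{0,2}=-2\gamma_{n+1}B_0D_{n+1},\quad G_{1,2}=\tfrac12C_n^+B_0+\Phi B_0',\quad H_2=\gamma_{n+1}\{\tfrac12C_n^+D_{n+1}-\Phi D_{n+1}'\},$$ $$M_{1,2}=\Phi(\Phi'+M_{0,1}),\quad M_{0,2}=\Phi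 M_{0,1}'+B_0D_0+\gamma_{n+1}D_nD_{n+1}.$$ For $k=3$: $$G_{0,3}=\gamma_{n+1}\{D_{n+1}C_n^-B_0-3\Phi(B_0D_{n+1})'\},$$ $$G_{1,3}=B_0\{\tfrac14(C_n^+)^2-2\gamma_{n+1}D_nD_{n+1}+\tfrac12\Phi(C_n^+)'\}+\Phi B_0'\{C_n^++\Phi'\}+\Phi^2B_0'',$$ $$H_3=\gamma_{n+1}\{2B_0D_0+\tfrac12(C_n^+)'\Phi-\tfrac14(C_n^+)^2\}D_{n+1}+\gamma_{n+1}\Phi(C_n^+-\Phi')D_{n+1}'-\gamma_{n+1}\Phi^2D_{n+1}'',$$ $$M_{2,3}=\Phi(M_{1,2}+2\Phi\Phi'),\quad M_{1,3}=\Phi(M_{0,2}+M_{1,2}'),\quad M_{0,3}=\Phi M_{0,2}'+D_0G_{1,2}-D_nH_2.$$ For $k=4$: $$G_{0,4}=-\tfrac12C_n^-G_{0,3}-\gamma_{n+1}D_{n+1}G_{1,3}+B_0H_3+\Phi G_{0,3}',$$ $$G_{1,4}=D_nG_{0,3}+\tfrac12C_n^+G_{1,3}+\Phi G_{1,3}',\qquad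 H_4=-D_0G_{0,3}-\tfrac12C_n^+H_3+\Phi H_3',$$ $$M_{3,4}=\Phi(M_{2,3}+3\Phi^2\Phi'),\quad M_{2,4}=\Phi(M_{2,3}'+M_{1,3}),\quad M_{1,4}=\Phi(M_{1,3}'+M_{0,3}),$$ $$M_{0,4}=\Phi M_{0,3}'+D_0G_{1,3}-D_nH_3.$$ -/

import Mathlib

open Polynomial

noncomputable section

/-- A form: a linear functional on the space of complex polynomials. -/
abbrev Form : Type := Module.Dual ℂ ℂ[X]

namespace Form

/-- `P` is the monic orthogonal polynomial sequence (MOPS) of the form `u`. -/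
structure IsMOPS (u : Form) (P : ℕ → ℂ[X]) : Prop where
  monic : ∀ n, (P n).Monic
  natDegree_eq : ∀ n, (P n).natDegree = n
  orthogonal : ∀ n m, n ≠ m → u (P n * P m) = 0
  norm_ne_zero : ∀ n, u (P n * P n) ≠ 0

/-- The formal Stieltjes function `S(u)(z) = - ∑_{n ≥ 0} ⟨u, x^n⟩ / z^(n+1)`,
as a formal power series in the variable `1/z`. -/
def stieltjes (u : Form) : PowerSeries ℂ :=
  -(PowerSeries.X * PowerSeries.mk fun n => u (X ^ n))

/-- The derivative of a series in `t = 1/z` with respect to `z`: `d/dz = - t^2 d/dt`. -/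
def derivZ (S : PowerSeries ℂ) : PowerSeries ℂ :=
  -(PowerSeries.X ^ 2 * PowerSeries.derivative ℂ S)

/-- The polynomial `A(z)` as a formal Laurent series in the variable `t = 1/z`. -/
def polyZ (A : ℂ[X]) : LaurentSeries ℂ :=
  aeval (HahnSeries.single (-1 : ℤ) (1 : ℂ) : LaurentSeries ℂ) A

/-- `u` is a Laguerre-Hahn form with Riccati equation
`Φ(z) S'(u)(z) = B(z) S(u)(z)^2 + C(z) S(u)(z) + D(z)`:
it is regular, normalized by `⟨u, 1⟩ = 1`, and its formal Stieltjes function satisfies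
that equation, in the field of formal Laurent series in `1/z`. -/
structure IsLaguerreHahn (u : Form) (Φ B C D : ℂ[X]) : Prop where
  regular : ∃ P : ℕ → ℂ[X], u.IsMOPS P
  normalized : u 1 = 1
  riccati : polyZ Φ * (derivZ u.stieltjes : LaurentSeries ℂ) =
    polyZ B * (u.stieltjes : LaurentSeries ℂ) ^ 2 +
      polyZ C * (u.stieltjes : LaurentSeries ℂ) + polyZ D

/-- The difference quotient `(p(x) - p(ξ)) / (x - ξ)`, as a polynomial in `x` (the outer variable)
whose coefficients are polynomials in `ξ` (the inner variable). -/
def diffQuot (p : ℂ[X]) : ℂ[X][X] :=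
  (p.map (C : ℂ →+* ℂ[X]) - C p) /ₘ (X - C X)

theorem diffQuot_spec (p : ℂ[X]) :
    (X - C X) * diffQuot p = p.map (C : ℂ →+* ℂ[X]) - C p := by
  unfold diffQuot
  rw [mul_divByMonic_eq_iff_isRoot]
  simp [IsRoot, eval_map, eval₂_C_X]

/-- `(u θ₀ p)(x) = ⟨u, (p(x) - p(ξ)) / (x - ξ)⟩`, where `u` acts on the variable `ξ`. -/
def assocOp (u : Form) (p : ℂ[X]) : ℂ[X] :=
  (diffQuot p).sum fun i c => monomial i (u c)

/-- The associated polynomials of order one,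
`P^{(1)}_n(x) = ⟨u, (P_{n+1}(x) - P_{n+1}(ξ)) / (x - ξ)⟩`, for the integers `n ≥ -1`.
For `n = -1` the difference quotient is that of the constant `P_0 = 1`: `P^{(1)}_{-1} = 0`. -/
def assoc (u : Form) (P : ℕ → ℂ[X]) (n : ℤ) : ℂ[X] :=
  u.assocOp (P (n + 1).toNat)

theorem assoc_neg_one {u : Form} {P : ℕ → ℂ[X]} (h : u.IsMOPS P) : u.assoc P (-1) = 0 := by
  have h0 : P 0 = 1 := (h.monic 0).natDegree_eq_zero.mp (h.natDegree_eq 0)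
  simp [assoc, assocOp, diffQuot, h0]

end Form

/-- The three-term recurrence relation with coefficients `β_n` (`n ≥ 0`) and `γ_n` (`n ≥ 1`);
the value `γ 0` is irrelevant. -/
structure IsRecurrence (P : ℕ → ℂ[X]) (β γ : ℕ → ℂ) : Prop where
  zero : P 0 = 1
  one : P 1 = X - C (β 0)
  add_two : ∀ n, P (n + 2) = (X - C (β (n + 1))) * P (n + 1) - C (γ (n + 1)) * P n
  gamma_ne_zero : ∀ n, γ (n + 1) ≠ 0

/-- The input of the coefficient formulas: the polynomials of the Riccati equation and the
recurrence coefficients. -/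
structure LHData where
  Φ : ℂ[X]
  B₀ : ℂ[X]
  C₀ : ℂ[X]
  D₀ : ℂ[X]
  β : ℕ → ℂ
  γ : ℕ → ℂ

namespace LHData

variable (K : LHData)

/-- The triple `(C_n, D_n, γ_n D_{n-1})`, where the third component is `B₀` for `n = 0`
(that is, `D_{-1} = B₀` with the convention `γ_0 = 1`). -/
def triple : ℕ → ℂ[X] × ℂ[X] × ℂ[X]
  | 0 => (K.C₀, K.D₀, K.B₀)
  | n + 1 =>
    let c := (triple n).1
    let d := (triple n).2.1
    let e := (triple n).2.2
    let ℓ := X - C (K.β n)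
    (-c + 2 * ℓ * d, (K.γ (n + 1))⁻¹ • (-K.Φ + e - ℓ * c + ℓ ^ 2 * d), K.γ (n + 1) • d)

/-- The polynomials `C_n`. -/
def Cn (n : ℕ) : ℂ[X] := (K.triple n).1

/-- The polynomials `D_n`. -/
def Dn (n : ℕ) : ℂ[X] := (K.triple n).2.1

theorem Cn_zero : K.Cn 0 = K.C₀ := rfl

theorem Dn_zero : K.Dn 0 = K.D₀ := rfl

theorem Cn_succ (n : ℕ) : K.Cn (n + 1) = -K.Cn n + 2 * (X - C (K.β n)) * K.Dn n := rfl

theorem Dn_one (h : K.γ 1 ≠ 0) :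
    K.γ 1 • K.Dn 1 =
      -K.Φ + K.B₀ - (X - C (K.β 0)) * K.Cn 0 + (X - C (K.β 0)) ^ 2 * K.Dn 0 :=
  smul_inv_smul₀ h _

theorem Dn_add_two (n : ℕ) (h : K.γ (n + 2) ≠ 0) :
    K.γ (n + 2) • K.Dn (n + 2) =
      -K.Φ + K.γ (n + 1) • K.Dn n - (X - C (K.β (n + 1))) * K.Cn (n + 1)
        + (X - C (K.β (n + 1))) ^ 2 * K.Dn (n + 1) :=
  smul_inv_smul₀ h _

/-- The sum `C_{n+1} + C_0`. -/
def Cplus (n : ℕ) : ℂ[X] := K.Cn (n + 1) + K.Cn 0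

/-- The difference `C_{n+1} - C_0`. -/
def Cminus (n : ℕ) : ℂ[X] := K.Cn (n + 1) - K.Cn 0

/-! The coefficients of the four relations. -/

def G01 (_K : LHData) (_n : ℕ) : ℂ[X] := 0

def G11 (_n : ℕ) : ℂ[X] := K.B₀

def H1 (n : ℕ) : ℂ[X] := -(K.γ (n + 1) • K.Dn (n + 1))

def M01 (n : ℕ) : ℂ[X] := -((1 / 2 : ℂ) • K.Cminus n)

def G02 (n : ℕ) : ℂ[X] := -((2 * K.γ (n + 1)) • (K.B₀ * K.Dn (n + 1)))

def G12 (n : ℕ) : ℂ[X] := (1 / 2 : ℂ) • K.Cplus n * K.B₀ + K.Φ * derivative K.B₀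

def H2 (n : ℕ) : ℂ[X] :=
  K.γ (n + 1) • ((1 / 2 : ℂ) • K.Cplus n * K.Dn (n + 1) - K.Φ * derivative (K.Dn (n + 1)))

def M12 (n : ℕ) : ℂ[X] := K.Φ * (derivative K.Φ + K.M01 n)

def M02 (n : ℕ) : ℂ[X] :=
  K.Φ * derivative (K.M01 n) + K.B₀ * K.D₀ + K.γ (n + 1) • (K.Dn n * K.Dn (n + 1))

def G03 (n : ℕ) : ℂ[X] :=
  K.γ (n + 1) •
    (K.Dn (n + 1) * K.Cminus n * K.B₀ - 3 * K.Φ * derivative (K.B₀ * K.Dn (n + 1)))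

def G13 (n : ℕ) : ℂ[X] :=
  K.B₀ * ((1 / 4 : ℂ) • K.Cplus n ^ 2 - (2 * K.γ (n + 1)) • (K.Dn n * K.Dn (n + 1))
      + (1 / 2 : ℂ) • (K.Φ * derivative (K.Cplus n)))
    + K.Φ * derivative K.B₀ * (K.Cplus n + derivative K.Φ)
    + K.Φ ^ 2 * derivative (derivative K.B₀)

def H3 (n : ℕ) : ℂ[X] :=
  K.γ (n + 1) • ((2 * K.B₀ * K.D₀ + (1 / 2 : ℂ) • (derivative (K.Cplus n) * K.Φ)
      - (1 / 4 : ℂ) • K.Cplus n ^ 2) * K.Dn (n + 1))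
    + K.γ (n + 1) • (K.Φ * (K.Cplus n - derivative K.Φ) * derivative (K.Dn (n + 1)))
    - K.γ (n + 1) • (K.Φ ^ 2 * derivative (derivative (K.Dn (n + 1))))

def M23 (n : ℕ) : ℂ[X] := K.Φ * (K.M12 n + 2 * K.Φ * derivative K.Φ)

def M13 (n : ℕ) : ℂ[X] := K.Φ * (K.M02 n + derivative (K.M12 n))

def M03 (n : ℕ) : ℂ[X] := K.Φ * derivative (K.M02 n) + K.D₀ * K.G12 n - K.Dn n * K.H2 n

def G04 (n : ℕ) : ℂ[X] :=
  -((1 / 2 : ℂ) • K.Cminus n * K.G03 n) - K.γ (n + 1) • (K.Dn (n + 1) * K.G13 n)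
    + K.B₀ * K.H3 n + K.Φ * derivative (K.G03 n)

def G14 (n : ℕ) : ℂ[X] :=
  K.Dn n * K.G03 n + (1 / 2 : ℂ) • K.Cplus n * K.G13 n + K.Φ * derivative (K.G13 n)

def H4 (n : ℕ) : ℂ[X] :=
  -(K.D₀ * K.G03 n) - (1 / 2 : ℂ) • K.Cplus n * K.H3 n + K.Φ * derivative (K.H3 n)

def M34 (n : ℕ) : ℂ[X] := K.Φ * (K.M23 n + 3 * K.Φ ^ 2 * derivative K.Φ)

def M24 (n : ℕ) : ℂ[X] := K.Φ * (derivative (K.M23 n) + K.M13 n)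

def M14 (n : ℕ) : ℂ[X] := K.Φ * (derivative (K.M13 n) + K.M03 n)

def M04 (n : ℕ) : ℂ[X] := K.Φ * derivative (K.M03 n) + K.D₀ * K.G13 n - K.Dn n * K.H3 n

end LHData

end

/-! ### Difference quotients and associated polynomials -/

namespace Form

/-! Put `q n` for $P^{(1)}_{n-1}$. Orthogonality gives the three-term recurrence of $P_n$, and `q`
satisfies the same recurrence with initial values $0, 1$. The span of $P_n, P_{n+1}, q_n, q_{n+1}$
over the polynomials is stable under $\Phi\,d/dx$: `structureRelations` proves this by induction on
$n$, with coefficients built from $B_0, D_0, C_n, D_n$. The first of these structure relations is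
the case $k=1$. Applying $\Phi\,d/dx$ to the relation for $k$, and eliminating every derivative
except those of $P_{n+1}$ on the right, gives the relation for $k+1$ (`StructureRelations.step`).
The case $k=4$ has exactly the coefficients this produces; for $k=3$ the closed forms have to be
matched with them. -/

theorem diffQuot_eq_of_mul_eq {p : ℂ[X]} {q : ℂ[X][X]}
    (h : (X - C X) * q = p.map (C : ℂ →+* ℂ[X]) - C p) : diffQuot p = q :=
  mul_left_cancel₀ (X_sub_C_ne_zero (X : ℂ[X])) ((diffQuot_spec p).trans h.symm)

theorem diffQuot_sub (p q : ℂ[X]) : diffQuot (p - q) = diffQuot p - diffQuot q := by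
  apply diffQuot_eq_of_mul_eq
  rw [mul_sub, diffQuot_spec, diffQuot_spec]
  simp only [Polynomial.map_sub, C_sub]
  ring

theorem diffQuot_C_mul (a : ℂ) (p : ℂ[X]) : diffQuot (C a * p) = C (C a) * diffQuot p := by
  apply diffQuot_eq_of_mul_eq
  rw [mul_left_comm, diffQuot_spec]
  simp only [Polynomial.map_mul, map_C, C_mul]
  ring

theorem diffQuot_X_mul (p : ℂ[X]) : diffQuot (X * p) = X * diffQuot p + C p := by
  apply diffQuot_eq_of_mul_eq
  rw [mul_add, mul_left_comm, diffQuot_spec]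
  simp only [Polynomial.map_mul, map_X, C_mul]
  ring

theorem diffQuot_one : diffQuot 1 = 0 :=
  diffQuot_eq_of_mul_eq (by simp)

theorem coeff_assocOp (u : Form) (p : ℂ[X]) (i : ℕ) :
    (u.assocOp p).coeff i = u ((diffQuot p).coeff i) := by
  simp only [assocOp, Polynomial.sum, finsetSum_coeff, coeff_monomial]
  rw [Finset.sum_ite_eq']
  split_ifs with h
  · rfl
  · rw [notMem_support_iff.mp h, map_zero]

theorem assocOp_sub (u : Form) (p q : ℂ[X]) :
    u.assocOp (p - q) = u.assocOp p - u.assocOp q := by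
  ext i
  simp [coeff_assocOp, diffQuot_sub]

theorem assocOp_C_mul (u : Form) (a : ℂ) (p : ℂ[X]) :
    u.assocOp (C a * p) = C a * u.assocOp p := by
  ext i
  rw [coeff_assocOp, diffQuot_C_mul, coeff_C_mul, coeff_C_mul, coeff_assocOp, ← smul_eq_C_mul,
    map_smul, smul_eq_mul]

/-- The extra constant `u p` vanishes at $P_{n+1}$ by orthogonality to $P_0=1$, so the associated
polynomials inherit the recurrence of $P$. -/
theorem assocOp_X_mul (u : Form) (p : ℂ[X]) :
    u.assocOp (X * p) = X * u.assocOp p + C (u p) := by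
  ext i
  rw [coeff_assocOp, diffQuot_X_mul, coeff_add, coeff_add, map_add]
  congr 1
  · cases i with
    | zero => simp
    | succ i => rw [coeff_X_mul, coeff_X_mul, coeff_assocOp]
  · simp only [coeff_C]
    split_ifs <;> simp

theorem assocOp_one (u : Form) : u.assocOp 1 = 0 := by
  ext i
  simp [coeff_assocOp, diffQuot_one]

theorem assocOp_X_sub_C (u : Form) (a : ℂ) : u.assocOp (X - C a) = C (u 1) := by
  have h : (X - C a : ℂ[X]) = X * 1 - C a * 1 := by ring
  rw [h, assocOp_sub, assocOp_X_mul, assocOp_C_mul, assocOp_one]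
  ring

/-! ### Orthogonality and the three-term recurrence -/

namespace IsMOPS

variable {u : Form} {P : ℕ → ℂ[X]}

theorem zero_eq_one (h : u.IsMOPS P) : P 0 = 1 :=
  (h.monic 0).natDegree_eq_zero.mp (h.natDegree_eq 0)

theorem degree_eq (h : u.IsMOPS P) (n : ℕ) : (P n).degree = n := by
  rw [degree_eq_natDegree (h.monic n).ne_zero, h.natDegree_eq]

theorem degree_sub_leadingCoeff_mul_lt (h : u.IsMOPS P) {p : ℂ[X]} (hp : p ≠ 0) :
    (p - C p.leadingCoeff * P p.natDegree).degree < p.degree := by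
  have hl : p.leadingCoeff ≠ 0 := leadingCoeff_ne_zero.mpr hp
  apply degree_sub_lt_left _ hp
  · rw [leadingCoeff_mul, leadingCoeff_C, (h.monic _).leadingCoeff, mul_one]
  · rw [degree_C_mul hl, h.degree_eq, degree_eq_natDegree hp]

theorem apply_mul_eq_zero (h : u.IsMOPS P) (n : ℕ) (p : ℂ[X]) (hp : p.degree < n) :
    u (p * P n) = 0 := by
  induction hd : p.degree using WellFoundedLT.induction generalizing p with
  | ind d ih =>
    by_cases h0 : p = 0
    · simp [h0]
    have hlt := h.degree_sub_leadingCoeff_mul_lt h0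
    have hne : p.natDegree ≠ n := by
      rintro rfl
      exact (degree_eq_natDegree h0 ▸ hp).false
    have hr := ih _ (hd ▸ hlt) _ (hlt.trans hp) rfl
    rw [sub_mul, map_sub, mul_assoc, ← smul_eq_C_mul, map_smul, h.orthogonal _ _ hne, smul_zero,
      sub_zero] at hr
    exact hr

theorem apply_mul_natDegree (h : u.IsMOPS P) (p : ℂ[X]) :
    u (p * P p.natDegree) = p.leadingCoeff * u (P p.natDegree * P p.natDegree) := by
  by_cases h0 : p = 0
  · simp [h0]
  have hr := h.apply_mul_eq_zero p.natDegree _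
    ((h.degree_sub_leadingCoeff_mul_lt h0).trans_le degree_le_natDegree)
  rw [sub_mul, map_sub, mul_assoc, ← smul_eq_C_mul, map_smul, smul_eq_mul, sub_eq_zero] at hr
  exact hr

/-- Pairing with $P_{\deg p}$ isolates the leading coefficient of `p` times a nonzero norm.
Polynomial identities can thus be tested against the $P_k$. -/
theorem eq_zero_of_forall_apply_mul_eq_zero (h : u.IsMOPS P) {p : ℂ[X]}
    (hp : ∀ n, u (p * P n) = 0) : p = 0 := by
  have h1 := h.apply_mul_natDegree p
  rw [hp, eq_comm, mul_eq_zero] at h1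
  exact leadingCoeff_eq_zero.mp (h1.resolve_right (h.norm_ne_zero _))

theorem natDegree_X_mul_self (h : u.IsMOPS P) (n : ℕ) : (X * P n).natDegree = n + 1 := by
  rw [natDegree_X_mul (h.monic n).ne_zero, h.natDegree_eq]

theorem degree_X_mul_self (h : u.IsMOPS P) (n : ℕ) : (X * P n).degree = ((n + 1 : ℕ) : WithBot ℕ) := by
  rw [degree_eq_natDegree (monic_X.mul (h.monic n)).ne_zero, h.natDegree_X_mul_self]

theorem apply_X_mul_mul_succ (h : u.IsMOPS P) (n : ℕ) :
    u (X * P n * P (n + 1)) = u (P (n + 1) * P (n + 1)) := by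
  have h1 := h.apply_mul_natDegree (X * P n)
  rwa [h.natDegree_X_mul_self, (monic_X.mul (h.monic n)).leadingCoeff, one_mul] at h1

theorem apply_X_mul_mul_of_lt (h : u.IsMOPS P) {m n : ℕ} (hmn : m + 1 < n) :
    u (X * P m * P n) = 0 :=
  h.apply_mul_eq_zero _ _ (by rw [h.degree_X_mul_self]; exact_mod_cast hmn)

theorem exists_add_two_eq (h : u.IsMOPS P) (n : ℕ) :
    ∃ b c : ℂ, c ≠ 0 ∧ P (n + 2) = (X - C b) * P (n + 1) - C c * P n := by
  have h0 := h.norm_ne_zero n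
  have h1 := h.norm_ne_zero (n + 1)
  -- The witnesses are forced by pairing the recurrence with $P_{n+1}$ and with $P_n$.
  refine ⟨u (X * P (n + 1) * P (n + 1)) / u (P (n + 1) * P (n + 1)),
    u (P (n + 1) * P (n + 1)) / u (P n * P n), div_ne_zero h1 h0, ?_⟩
  rw [eq_comm, ← sub_eq_zero]
  apply h.eq_zero_of_forall_apply_mul_eq_zero
  intro k
  rw [sub_mul, sub_mul, sub_mul, sub_mul, mul_assoc (C _), mul_assoc (C _), ← smul_eq_C_mul,
    ← smul_eq_C_mul, map_sub, map_sub, map_sub, map_smul, map_smul, smul_eq_mul, smul_eq_mul]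
  have swap (m : ℕ) : u (X * P m * P k) = u (X * P k * P m) := by
    congr 1
    ring
  rcases lt_trichotomy k n with hk | rfl | hk
  · rw [swap, h.apply_X_mul_mul_of_lt (by lia), h.orthogonal (n + 1) k (by lia),
      h.orthogonal n k (by lia), h.orthogonal (n + 2) k (by lia)]
    ring
  · rw [swap, h.apply_X_mul_mul_succ, h.orthogonal (k + 1) k (by lia),
      h.orthogonal (k + 2) k (by lia), div_mul_cancel₀ _ h0]
    ring
  obtain rfl | rfl | hk : k = n + 1 ∨ k = n + 2 ∨ n + 2 < k := by lia
  · rw [h.orthogonal n (n + 1) (by lia), h.orthogonal (n + 2) (n + 1) (by lia),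
      div_mul_cancel₀ _ h1]
    ring
  · rw [h.apply_X_mul_mul_succ, h.orthogonal (n + 1) (n + 2) (by lia),
      h.orthogonal n (n + 2) (by lia)]
    ring
  · rw [h.apply_X_mul_mul_of_lt (by lia), h.orthogonal (n + 1) k (by lia),
      h.orthogonal n k (by lia), h.orthogonal (n + 2) k (by lia)]
    ring

theorem exists_isRecurrence (h : u.IsMOPS P) : ∃ β γ : ℕ → ℂ, IsRecurrence P β γ := by
  choose b c hc hbc using h.exists_add_two_eq
  have h1 : P 1 = X - C (-(P 1).coeff 0) := by
    rw [C_neg, sub_neg_eq_add]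
    exact (h.monic 1).eq_X_add_C (h.natDegree_eq 1)
  let β : ℕ → ℂ
    | 0 => -(P 1).coeff 0
    | n + 1 => b n
  -- At index 0 truncated subtraction yields the irrelevant value `c 0`.
  exact ⟨β, fun n => c (n - 1), ⟨h.zero_eq_one, h1, fun n => hbc n, fun n => hc n⟩⟩

theorem apply_eq_zero (h : u.IsMOPS P) (n : ℕ) : u (P (n + 1)) = 0 := by
  simpa [h.zero_eq_one] using h.orthogonal 0 (n + 1) (by lia)

theorem assocOp_add_two (h : u.IsMOPS P) {β γ : ℕ → ℂ} (hr : IsRecurrence P β γ) (n : ℕ) :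
    u.assocOp (P (n + 2)) =
      (X - C (β (n + 1))) * u.assocOp (P (n + 1)) - C (γ (n + 1)) * u.assocOp (P n) := by
  rw [hr.add_two, sub_mul, assocOp_sub, assocOp_sub, assocOp_X_mul, assocOp_C_mul, assocOp_C_mul,
    h.apply_eq_zero]
  simp only [C_0]
  ring

end IsMOPS

end Form

/-! ### Structure relations -/

theorem two_mul_C_half : (2 : ℂ[X]) * C (1 / 2) = 1 := by
  rw [show (2 : ℂ[X]) = C 2 from rfl, ← C_mul]
  norm_num

namespace LHData

/-- The product `γ_n D_{n-1}`, which is `B₀` for `n = 0`. -/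
noncomputable def gammaD (K : LHData) (n : ℕ) : ℂ[X] := (K.triple n).2.2

theorem gammaD_zero (K : LHData) : K.gammaD 0 = K.B₀ := rfl

theorem gammaD_succ (K : LHData) (n : ℕ) : K.gammaD (n + 1) = C (K.γ (n + 1)) * K.Dn n :=
  smul_eq_C_mul _

theorem C_mul_Dn_succ (K : LHData) (n : ℕ) (h : K.γ (n + 1) ≠ 0) :
    C (K.γ (n + 1)) * K.Dn (n + 1) =
      -K.Φ + K.gammaD n - (X - C (K.β n)) * K.Cn n + (X - C (K.β n)) ^ 2 * K.Dn n := by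
  rw [← smul_eq_C_mul]
  exact smul_inv_smul₀ h _

/-- Two solutions `p` and `q` (the latter shifted by one) of the three-term recurrence satisfy
the first-order structure relations attached to `K`: the right-hand sides are the derivatives,
multiplied by `Φ`, of `p (n + 1)`, `p n`, `q (n + 1)` and `q n`. -/
structure StructureRelations (K : LHData) (p q : ℕ → ℂ[X]) (n : ℕ) : Prop where
  deriv_succ : K.Φ * derivative (p (n + 1)) =
    C (1 / 2) * K.Cminus n * p (n + 1) - C (K.γ (n + 1)) * K.Dn (n + 1) * p n + K.B₀ * q (n + 1)
  deriv : K.Φ * derivative (p n) =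
    -(C (1 / 2) * K.Cplus n * p n) + K.Dn n * p (n + 1) + K.B₀ * q n
  deriv_assoc_succ : K.Φ * derivative (q (n + 1)) =
    C (1 / 2) * K.Cplus n * q (n + 1) - K.D₀ * p (n + 1) - C (K.γ (n + 1)) * K.Dn (n + 1) * q n
  deriv_assoc : K.Φ * derivative (q n) =
    -(C (1 / 2) * K.Cminus n * q n) - K.D₀ * p n + K.Dn n * q (n + 1)

/-- The recurrences of $C_n$ and $D_n$ are exactly what carries the four relations from $n$ to
$n+1$. -/
theorem structureRelations (K : LHData) (p q : ℕ → ℂ[X]) (hγ : ∀ n, K.γ (n + 1) ≠ 0)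
    (p_zero : p 0 = 1) (p_one : p 1 = X - C (K.β 0))
    (p_add_two : ∀ n, p (n + 2) = (X - C (K.β (n + 1))) * p (n + 1) - C (K.γ (n + 1)) * p n)
    (q_zero : q 0 = 0) (q_one : q 1 = 1)
    (q_add_two : ∀ n, q (n + 2) = (X - C (K.β (n + 1))) * q (n + 1) - C (K.γ (n + 1)) * q n)
    (n : ℕ) : K.StructureRelations p q n := by
  have hh := two_mul_C_half
  -- One half becomes an atom `c` with $2c=1$, so that `ring` treats the identities as polynomial
  -- ones.
  generalize hc : (C (1 / 2) : ℂ[X]) = c at hh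
  induction n with
  | zero =>
    have hD := K.C_mul_Dn_succ 0 (hγ 0)
    rw [K.gammaD_zero] at hD
    constructor <;>
      simp only [zero_add] at * <;>
      simp only [hc, p_zero, p_one, q_zero, q_one, Cminus, Cplus, Cn_succ, Cn_zero, Dn_zero,
        derivative_sub, derivative_X, derivative_C, derivative_one, derivative_zero] at *
    · linear_combination hD + (K.C₀ * (X - C (K.β 0)) - (X - C (K.β 0)) ^ 2 * K.D₀) * hh
    · linear_combination (X - C (K.β 0)) * K.D₀ * hh
    · linear_combination -(X - C (K.β 0)) * K.D₀ * hh
    · ring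
  | succ n ih =>
    obtain ⟨h1, h2, h3, h4⟩ := ih
    have hD := K.C_mul_Dn_succ (n + 1) (hγ (n + 1))
    rw [K.gammaD_succ] at hD
    have hC := K.Cn_succ (n + 1)
    have hp := p_add_two n
    have hq := q_add_two n
    have dp := congrArg derivative hp
    have dq := congrArg derivative hq
    simp only [derivative_sub, derivative_mul, derivative_X, derivative_C] at dp dq
    simp only [hc, Cminus, Cplus] at h1 h2 h3 h4
    -- This is `h1` with $\gamma_{n+1}p_n$ replaced by $(x-\beta_{n+1})p_{n+1}-p_{n+2}$; the
    -- recurrence of $C_n$ absorbs the extra multiple of $p_{n+1}$.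
    have h2' : K.Φ * derivative (p (n + 1)) =
        -(c * K.Cplus (n + 1) * p (n + 1)) + K.Dn (n + 1) * p (n + 2) + K.B₀ * q (n + 1) := by
      rw [Cplus, hC, hp, h1]
      linear_combination (X - C (K.β (n + 1))) * K.Dn (n + 1) * p (n + 1) * hh
    have h4' : K.Φ * derivative (q (n + 1)) =
        -(c * K.Cminus (n + 1) * q (n + 1)) - K.D₀ * p (n + 1) + K.Dn (n + 1) * q (n + 2) := by
      rw [Cminus, hC, hq, h3]
      linear_combination (X - C (K.β (n + 1))) * K.Dn (n + 1) * q (n + 1) * hh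
    refine ⟨?_, hc ▸ h2', ?_, hc ▸ h4'⟩
    -- Differentiating the recurrence leaves a term $\Phi p_{n+1}$, which `hD` exchanges for
    -- $\gamma_{n+2}D_{n+2}p_{n+1}$ and lower data.
    · rw [hc, Cminus, hC]
      rw [Cplus, hC] at h2'
      linear_combination K.Φ * dp + (X - C (K.β (n + 1))) * h2' - C (K.γ (n + 1)) * h2
        + p (n + 1) * hD - K.B₀ * hq + c * (K.Cn (n + 1) + K.Cn 0) * hp
        + ((X - C (K.β (n + 1))) * K.Cn (n + 1) - (X - C (K.β (n + 1))) ^ 2 * K.Dn (n + 1))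
          * p (n + 1) * hh - (X - C (K.β (n + 1))) * K.Dn (n + 1) * p (n + 2) * hh
    · rw [hc, Cplus, hC]
      rw [Cminus, hC] at h4'
      linear_combination K.Φ * dq + (X - C (K.β (n + 1))) * h4' - C (K.γ (n + 1)) * h4
        + q (n + 1) * hD + K.D₀ * hp + c * (K.Cn (n + 1) - K.Cn 0) * hq
        + ((X - C (K.β (n + 1))) * K.Cn (n + 1) - (X - C (K.β (n + 1))) ^ 2 * K.Dn (n + 1))
          * q (n + 1) * hh - (X - C (K.β (n + 1))) * K.Dn (n + 1) * q (n + 2) * hh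

/-- Differentiating a relation between `p n`, `p (n + 1)`, `q n`, `q (n + 1)` by means of the
structure relations. -/
theorem StructureRelations.step {K : LHData} {p q : ℕ → ℂ[X]} {n : ℕ}
    (h : K.StructureRelations p q n) {G₀ G₁ H L M : ℂ[X]}
    (e : G₀ * q n + G₁ * q (n + 1) + H * p n = L + M * p (n + 1)) :
    (-(C (1 / 2) * K.Cminus n * G₀) - C (K.γ (n + 1)) * K.Dn (n + 1) * G₁ + K.B₀ * H
        + K.Φ * derivative G₀) * q n
      + (K.Dn n * G₀ + C (1 / 2) * K.Cplus n * G₁ + K.Φ * derivative G₁) * q (n + 1)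
      + (-(K.D₀ * G₀) - C (1 / 2) * K.Cplus n * H + K.Φ * derivative H) * p n
      = K.Φ * derivative L + K.Φ * M * derivative (p (n + 1))
        + (K.Φ * derivative M + K.D₀ * G₁ - K.Dn n * H) * p (n + 1) := by
  have d := congrArg derivative e
  simp only [derivative_add, derivative_mul] at d
  -- `deriv_succ` is left out, so the derivatives of $p_{n+1}$ survive on the right; the multiples
  -- of $p_{n+1}$ created on the left move over to its coefficient there.
  linear_combination K.Φ * d - G₀ * h.deriv_assoc - G₁ * h.deriv_assoc_succ - H * h.deriv

end LHData

/-! ### The relations of orders one to four -/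

theorem theorem3p3 (u : Form) (P : ℕ → ℂ[X]) (Φ B C D : ℂ[X])
    (hu : u.IsLaguerreHahn Φ B C D) (hP : u.IsMOPS P) :
    (∃ β γ : ℕ → ℂ, IsRecurrence P β γ) ∧
    ∀ β γ : ℕ → ℂ, IsRecurrence P β γ →
      ∀ K : LHData, K = ⟨Φ, B, C, D, β, γ⟩ →
      ∀ n : ℕ,
        (K.G01 n * u.assoc P (n - 1) + K.G11 n * u.assoc P n + K.H1 n * P n =
          Φ * derivative (P (n + 1)) + K.M01 n * P (n + 1)) ∧
        (K.G02 n * u.assoc P (n - 1) + K.G12 n * u.assoc P n + K.H2 n * P n =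
          Φ ^ 2 * derivative^[2] (P (n + 1)) + K.M12 n * derivative (P (n + 1))
            + K.M02 n * P (n + 1)) ∧
        (K.G03 n * u.assoc P (n - 1) + K.G13 n * u.assoc P n + K.H3 n * P n =
          Φ ^ 3 * derivative^[3] (P (n + 1)) + K.M23 n * derivative^[2] (P (n + 1))
            + K.M13 n * derivative (P (n + 1)) + K.M03 n * P (n + 1)) ∧
        (K.G04 n * u.assoc P (n - 1) + K.G14 n * u.assoc P n + K.H4 n * P n =
          Φ ^ 4 * derivative^[4] (P (n + 1)) + K.M34 n * derivative^[3] (P (n + 1))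
            + K.M24 n * derivative^[2] (P (n + 1)) + K.M14 n * derivative (P (n + 1))
            + K.M04 n * P (n + 1)) := by
  refine ⟨hP.exists_isRecurrence, fun β γ hr K hK n => ?_⟩
  obtain rfl : K.Φ = Φ := by rw [hK]
  obtain rfl : K.β = β := by rw [hK]
  obtain rfl : K.γ = γ := by rw [hK]
  have q_one : u.assocOp (P 1) = 1 := by
    rw [hr.one, Form.assocOp_X_sub_C, hu.normalized, Polynomial.C_1]
  have hs := K.structureRelations P (fun m => u.assocOp (P m)) hr.gamma_ne_zero hr.zero hr.one
    hr.add_two (by simp only [hr.zero, Form.assocOp_one]) q_one (hP.assocOp_add_two hr) n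
  have a0 : u.assoc P (n - 1) = u.assocOp (P n) := by simp [Form.assoc]
  have a1 : u.assoc P n = u.assocOp (P (n + 1)) := by
    simp only [Form.assoc]
    congr 2
  rw [a0, a1]
  clear a0 a1 q_one hr hu hP hK
  have hh := two_mul_C_half
  have h4 : (Polynomial.C (1 / 4) : ℂ[X]) = Polynomial.C (1 / 2) ^ 2 := by
    rw [← Polynomial.C_pow]; norm_num
  have e1 : K.G01 n * u.assocOp (P n) + K.G11 n * u.assocOp (P (n + 1)) + K.H1 n * P n =
      K.Φ * derivative (P (n + 1)) + K.M01 n * P (n + 1) := by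
    have := hs.deriv_succ
    simp only [LHData.G01, LHData.G11, LHData.H1, LHData.M01, smul_eq_C_mul]
    linear_combination -this
  have e2 : K.G02 n * u.assocOp (P n) + K.G12 n * u.assocOp (P (n + 1)) + K.H2 n * P n =
      K.Φ ^ 2 * derivative^[2] (P (n + 1)) + K.M12 n * derivative (P (n + 1))
        + K.M02 n * P (n + 1) := by
    have := hs.step e1
    simp only [LHData.G01, LHData.G11, LHData.H1, LHData.G02, LHData.G12, LHData.H2, LHData.M12,
      LHData.M02, smul_eq_C_mul, derivative_mul, derivative_neg, derivative_C, derivative_zero,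
      C_mul, Function.iterate_succ, Function.iterate_zero, Function.comp_apply, id] at this ⊢
    simp only [show Polynomial.C (2 : ℂ) = 2 from rfl]
    linear_combination this
  have e3 : K.G03 n * u.assocOp (P n) + K.G13 n * u.assocOp (P (n + 1)) + K.H3 n * P n =
      K.Φ ^ 3 * derivative^[3] (P (n + 1)) + K.M23 n * derivative^[2] (P (n + 1))
        + K.M13 n * derivative (P (n + 1)) + K.M03 n * P (n + 1) := by
    -- The closed forms for $k=3$ agree with the output of `step` applied to `e2`.
    have g0 : K.G03 n = -(Polynomial.C (1 / 2) * K.Cminus n * K.G02 n)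
        - Polynomial.C (K.γ (n + 1)) * K.Dn (n + 1) * K.G12 n + K.B₀ * K.H2 n
        + K.Φ * derivative (K.G02 n) := by
      simp only [LHData.G03, LHData.G02, LHData.G12, LHData.H2, smul_eq_C_mul, derivative_mul,
        derivative_neg, derivative_C, C_mul, show Polynomial.C (2 : ℂ) = 2 from rfl,
        derivative_ofNat]
      linear_combination -(K.Cminus n * K.B₀ * Polynomial.C (K.γ (n + 1)) * K.Dn (n + 1)) * hh
    have g1 : K.G13 n = K.Dn n * K.G02 n + Polynomial.C (1 / 2) * K.Cplus n * K.G12 n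
        + K.Φ * derivative (K.G12 n) := by
      simp only [LHData.G13, LHData.G02, LHData.G12, smul_eq_C_mul, derivative_mul,
        derivative_add, derivative_C, C_mul, show Polynomial.C (2 : ℂ) = 2 from rfl, h4]
      linear_combination -(K.Cplus n * K.Φ * derivative K.B₀) * hh
    have g2 : K.H3 n = -(K.D₀ * K.G02 n) - Polynomial.C (1 / 2) * K.Cplus n * K.H2 n
        + K.Φ * derivative (K.H2 n) := by
      simp only [LHData.H3, LHData.G02, LHData.H2, smul_eq_C_mul, derivative_mul,
        derivative_sub, derivative_C, C_mul, show Polynomial.C (2 : ℂ) = 2 from rfl, h4]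
      linear_combination -(Polynomial.C (K.γ (n + 1)) * K.Cplus n * K.Φ
        * derivative (K.Dn (n + 1))) * hh
    have := hs.step e2
    rw [← g0, ← g1, ← g2] at this
    rw [this]
    simp only [LHData.M23, LHData.M13, LHData.M03, derivative_mul, derivative_add, derivative_pow,
      Function.iterate_succ, Function.iterate_zero, Function.comp_apply, id]
    norm_num
    simp only [show Polynomial.C (2 : ℂ) = 2 from rfl]
    ring
  refine ⟨e1, e2, e3, ?_⟩
  have := hs.step e3
  simp only [LHData.G04, LHData.G14, LHData.H4, LHData.M34, LHData.M24, LHData.M14, LHData.M04,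
    smul_eq_C_mul]
  simp only [derivative_mul, derivative_add, derivative_pow,
      Function.iterate_succ, Function.iterate_zero, Function.comp_apply, id] at this ⊢
  norm_num at this ⊢
  simp only [show Polynomial.C (3 : ℂ) = 3 from rfl] at this
  linear_combination this
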